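/- Let $R>1$, $N>1$ and $q\ge 1$ be integers with $\gcd(R,N)=1$, let $s\ge 0$, and let $p_1<p_2<\cdots<p_s$ be positive integers with $p_s<q$ (for $s=0$ there are no $p_i$). Put $M=RN^q$ and $$D=\{0,1,\dots,N-1\}\oplus N^{p_1}\{0,1,\dots,N-1\}\oplus\cdots\oplus N^{p_s}\{0,1,\dots,N-1\},$$ where $A\oplus B=\{a+b: a\in A,\ b\in B\}$. Let $\mu_{M,D}$ be the self-similar measure of $(M,D)$, that is, the unique compactly supported Borel probability measure on $\mathbb{R}$ such that $$\mu_{M,D}(E)=\frac{1}{\#D}\sum_{d\in D}\mu_{M,D}(\tau_d^{-1}(E)),\qquad \tau_d(x)=M^{-1}(x+d),$$ for every Borel set $E\subset\mathbb{R}$. Then $\mu_{M,D}$ is a spectral measure, that is, there is a countable discrete set $\Lambda\subset\mathbb{R}$ (called a spectrum of $\mu_{M,D}$) such that $\{e^{2\pi i\lambda x}:\lambda\in\Lambda\}$ is an orthonormal basis of $L^2(\mu_{M,D})$. Moreover, a spectrum of $\mu_{M,D}$ is $$\Lambda=\left\{\sum_{j=1}^{k}(RN^q)^{j-1}l_j :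 k\ge 1 \text{ and all } l_j\in L\right\},$$ where $$L=RN^q\left(\frac1N\{0,1,\dots,N-1\}\oplus\frac{1}{N^{p_1+1}}\{0,1,\dots,N-1\}\oplus\cdots\oplus\frac{1}{N^{p_s+1}}\{0,1,\dots,N-1\}\right).$$ -/

import Mathlib

open MeasureTheory
open scoped ENNReal Topology

noncomputable section

/-- `Λ` is a spectrum of `μ`: a countable discrete set of real numbers such that the exponentials
`x ↦ e^{2πiλx}`, `λ ∈ Λ`, form an orthonormal (Hilbert) basis of `L²(μ)`. -/
def IsSpectrum (μ : Measure ℝ) (Λ : Set ℝ) : Prop :=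
  Λ.Countable ∧ IsDiscrete Λ ∧
    ∃ b : HilbertBasis Λ ℂ (Lp ℂ 2 μ), ∀ l : Λ,
      ⇑(b l) =ᵐ[μ] fun x : ℝ => Complex.exp (2 * Real.pi * Complex.I * ((l : ℝ) : ℂ) * (x : ℂ))

/-- A spectral measure is a compactly supported Borel probability measure on `ℝ`
that has a spectrum. -/
def IsSpectralMeasure (μ : Measure ℝ) : Prop :=
  IsProbabilityMeasure μ ∧ (∃ K : Set ℝ, IsCompact K ∧ μ Kᶜ = 0) ∧ ∃ Λ : Set ℝ, IsSpectrum μ Λ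

/-- `μ` is a compactly supported Borel probability measure with
`μ(E) = (1 / #D) ∑_{d ∈ D} μ(τ_d⁻¹(E))` for all Borel sets `E`, where `τ_d(x) = M⁻¹(x + d)`. -/
structure IsSelfSimilarMeasure (M : ℝ) (D : Finset ℝ) (μ : Measure ℝ) : Prop where
  isProbabilityMeasure : IsProbabilityMeasure μ
  compactSupport : ∃ K : Set ℝ, IsCompact K ∧ μ Kᶜ = 0
  selfSimilar : ∀ E : Set ℝ, MeasurableSet E →
    μ E = (D.card : ℝ≥0∞)⁻¹ * ∑ d ∈ D, μ ((fun x : ℝ => M⁻¹ * (x + d)) ⁻¹' E)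

open Classical in
/-- The self-similar measure `μ_{M,D}`. For `M > 1` and nonempty `D` it is the one and only measure
with `IsSelfSimilarMeasure M D`, see `isSelfSimilarMeasure_iff`; the value `0` below is used only
where no such measure exists. -/
def selfSimilarMeasure (M : ℝ) (D : Finset ℝ) : Measure ℝ :=
  if h : ∃ μ : Measure ℝ, IsSelfSimilarMeasure M D μ then h.choose else 0

/-- Fourier transform of the self-similarity relation. -/
theorem IsSelfSimilarMeasure.charFun_eq {M : ℝ} {D : Finset ℝ} {μ : Measure ℝ}
    (h : IsSelfSimilarMeasure M D μ) (t : ℝ) :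
    charFun μ t = (D.card : ℂ)⁻¹ * (∑ d ∈ D, Complex.exp ((M⁻¹ * t * d : ℝ) * Complex.I)) *
      charFun μ (M⁻¹ * t) := by
  have := h.isProbabilityMeasure
  have hm : ∀ d : ℝ, Measurable (fun x : ℝ => M⁻¹ * (x + d)) := fun d => by fun_prop
  have key : μ = (D.card : ℝ≥0∞)⁻¹ •
      ∑ d ∈ D, μ.map (fun x : ℝ => M⁻¹ * (x + d)) := by
    ext E hE
    rw [h.selfSimilar E hE]
    simp only [Measure.smul_apply, Measure.finsetSum_apply, smul_eq_mul]
    congr 1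
    exact Finset.sum_congr rfl fun d _ => (Measure.map_apply (hm d) hE).symm
  have hint : ∀ (ν : Measure ℝ) [IsFiniteMeasure ν],
      Integrable (fun x : ℝ => Complex.exp (t * x * Complex.I)) ν := by
    intro ν _
    refine Integrable.of_bound (C := 1) (by fun_prop) (Filter.Eventually.of_forall fun x => ?_)
    rw [← Complex.ofReal_mul, Complex.norm_exp_ofReal_mul_I]
  have e : charFun μ t = (D.card : ℂ)⁻¹ *
      ∑ d ∈ D, charFun (μ.map (fun x : ℝ => M⁻¹ * (x + d))) t := by
    conv_lhs => rw [key]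
    simp only [charFun_apply_real]
    rw [integral_smul_measure, integral_finsetSum_measure]
    · simp [Complex.real_smul]
    · intro d _
      exact hint _
  rw [e, mul_assoc, Finset.sum_mul]
  congr 1
  refine Finset.sum_congr rfl fun d _ => ?_
  simp only [charFun_apply_real]
  rw [integral_map (hm d).aemeasurable (by fun_prop), ← integral_const_mul]
  refine integral_congr_ae (Filter.Eventually.of_forall fun x => ?_)
  simp only
  rw [← Complex.exp_add]
  congr 1
  push_cast
  ring

theorem IsSelfSimilarMeasure.unique {M : ℝ} (hM : 1 < M) {D : Finset ℝ} (hD : D.Nonempty)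
    {μ ν : Measure ℝ} (hμ : IsSelfSimilarMeasure M D μ) (hν : IsSelfSimilarMeasure M D ν) :
    μ = ν := by
  have := hμ.isProbabilityMeasure
  have := hν.isProbabilityMeasure
  have step : ∀ t : ℝ, ‖charFun μ t - charFun ν t‖ ≤
      ‖charFun μ (M⁻¹ * t) - charFun ν (M⁻¹ * t)‖ := by
    intro t
    rw [hμ.charFun_eq t, hν.charFun_eq t, ← mul_sub, norm_mul]
    refine mul_le_of_le_one_left (norm_nonneg _) ?_
    have hc : (0 : ℝ) < D.card := by exact_mod_cast hD.card_pos
    rw [norm_mul, norm_inv, Complex.norm_natCast, inv_mul_le_iff₀ hc, mul_one]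
    refine (norm_sum_le _ _).trans ?_
    simp only [Complex.norm_exp_ofReal_mul_I]
    simp
  refine Measure.ext_of_charFun (funext fun t => ?_)
  have it : ∀ n : ℕ, ‖charFun μ t - charFun ν t‖ ≤
      ‖charFun μ (M⁻¹ ^ n * t) - charFun ν (M⁻¹ ^ n * t)‖ := by
    intro n
    induction n with
    | zero => simp
    | succ n ih =>
      refine ih.trans ((step _).trans (le_of_eq ?_))
      rw [pow_succ', mul_assoc]
  have lim : Filter.Tendsto (fun n : ℕ => M⁻¹ ^ n * t) Filter.atTop (𝓝 0) := by
    have := (tendsto_pow_atTop_nhds_zero_of_lt_one (by positivity)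
      (inv_lt_one_of_one_lt₀ hM)).mul_const t
    simpa using this
  have c : Continuous fun t : ℝ => ‖charFun μ t - charFun ν t‖ :=
    (continuous_charFun.sub continuous_charFun).norm
  have l2 := (c.tendsto 0).comp lim
  have := ge_of_tendsto' l2 it
  simp only [charFun_zero, probReal_univ, sub_self, norm_zero] at this
  exact sub_eq_zero.mp (norm_le_zero_iff.mp this)

/-- Adding a first coordinate to an i.i.d. sequence gives an i.i.d. sequence. -/
theorem infinitePi_map_cons {X : Type} [MeasurableSpace X] (ν : Measure X)
    [IsProbabilityMeasure ν] :
    (ν.prod (Measure.infinitePi fun _ : ℕ => ν)).map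
      (fun z : X × (ℕ → X) => (fun n => Nat.casesOn n z.1 z.2 : ℕ → X)) =
    Measure.infinitePi fun _ : ℕ => ν := by
  classical
  have hm : Measurable (fun z : X × (ℕ → X) => (fun n => Nat.casesOn n z.1 z.2 : ℕ → X)) := by
    refine measurable_pi_lambda _ fun n => ?_
    cases n with
    | zero => exact measurable_fst
    | succ n => exact (measurable_pi_apply n).comp measurable_snd
  refine Measure.eq_infinitePi _ fun s t ht => ?_
  obtain ⟨n, hn⟩ : ∃ n, s ⊆ Finset.range (n + 1) :=
    ⟨s.sup id, fun i hi => Finset.mem_range_succ_iff.2 (Finset.le_sup (f := id) hi)⟩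
  rw [Measure.map_apply hm (.pi s.countable_toSet fun _ _ => ht _)]
  let t' : ℕ → Set X := fun i => if i ∈ s then t i else Set.univ
  have ht' : ∀ i, MeasurableSet (t' i) := by
    intro i
    by_cases h : i ∈ s <;> simp [t', h, ht]
  have e1 : (fun z : X × (ℕ → X) => (fun n => Nat.casesOn n z.1 z.2 : ℕ → X)) ⁻¹'
      (s : Set ℕ).pi t =
      t' 0 ×ˢ ((Finset.range n : Finset ℕ) : Set ℕ).pi (fun i => t' (i + 1)) := by
    ext ⟨x, w⟩
    simp only [Set.mem_preimage, Set.mem_pi, Set.mem_prod, Finset.mem_coe, Finset.mem_range]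
    constructor
    · intro h
      refine ⟨?_, fun i _ => ?_⟩
      · by_cases h0 : 0 ∈ s
        · simpa [t', h0] using h 0 h0
        · simp [t', h0]
      · by_cases h0 : i + 1 ∈ s
        · simpa [t', h0] using h (i + 1) h0
        · simp [t', h0]
    · rintro ⟨h0, h1⟩ i hi
      cases i with
      | zero => simpa [t', hi] using h0
      | succ i =>
        have := h1 i (by simpa using hn hi)
        simpa [t', hi] using this
  rw [e1, Measure.prod_prod, Measure.infinitePi_pi _ (fun i _ => ht' _), mul_comm,
    ← Finset.prod_range_succ' (fun i => ν (t' i)) n, ← Finset.prod_subset hn]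
  · exact Finset.prod_congr rfl fun i hi => by simp [t', hi]
  · intro i _ hi
    simp [t', hi]

/-- Existence: the law of `∑_{k ≥ 1} M⁻ᵏ d_k` with independent uniform digits `d_k ∈ D`. -/
theorem exists_isSelfSimilarMeasure {M : ℝ} (hM : 1 < M) {D : Finset ℝ} (hD : D.Nonempty) :
    ∃ μ : Measure ℝ, IsSelfSimilarMeasure M D μ := by
  have hc0 : (D.card : ℝ≥0∞) ≠ 0 := by exact_mod_cast hD.card_pos.ne'
  have hct : (D.card : ℝ≥0∞) ≠ ⊤ := ENNReal.natCast_ne_top _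
  let ν : Measure D := (D.card : ℝ≥0∞)⁻¹ • Measure.count
  have hν : IsProbabilityMeasure ν := ⟨by
    simp [ν, Measure.count_univ, ENNReal.inv_mul_cancel hc0 hct]⟩
  let P : Measure (ℕ → D) := Measure.infinitePi fun _ : ℕ => ν
  let S : (ℕ → D) → ℝ := fun w => ∑' k, M⁻¹ ^ (k + 1) * (w k : ℝ)
  have hM0 : 0 ≤ M⁻¹ := by positivity
  have hM1 : M⁻¹ < 1 := inv_lt_one_of_one_lt₀ hM
  obtain ⟨C, hC⟩ : ∃ C : ℝ, ∀ d : D, |(d : ℝ)| ≤ C :=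
    ⟨∑ d ∈ D, |d|, fun d => Finset.single_le_sum (f := fun d : ℝ => |d|)
      (fun _ _ => abs_nonneg _) d.2⟩
  have hsum : Summable fun k : ℕ => M⁻¹ ^ (k + 1) * C :=
    ((summable_nat_add_iff 1).2 (summable_geometric_of_lt_one hM0 hM1)).mul_right C
  have hb : ∀ (k : ℕ) (w : ℕ → D), ‖M⁻¹ ^ (k + 1) * (w k : ℝ)‖ ≤ M⁻¹ ^ (k + 1) * C := by
    intro k w
    rw [Real.norm_eq_abs, abs_mul, abs_of_nonneg (pow_nonneg hM0 _)]
    exact mul_le_mul_of_nonneg_left (hC _) (pow_nonneg hM0 _)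
  have hS : Continuous S := continuous_tsum (fun k => by fun_prop) hsum hb
  have hSm : Measurable S := hS.measurable
  let cons : D × (ℕ → D) → (ℕ → D) := fun z => fun n => Nat.casesOn n z.1 z.2
  have hcons : Measurable cons := by
    refine measurable_pi_lambda _ fun n => ?_
    cases n with
    | zero => exact measurable_fst
    | succ n => exact (measurable_pi_apply n).comp measurable_snd
  have hScons : ∀ z, S (cons z) = M⁻¹ * (S z.2 + z.1) := by
    intro z
    have h1 : ∀ w : ℕ → D, Summable fun k : ℕ => M⁻¹ ^ (k + 1) * (w k : ℝ) := fun w =>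
      Summable.of_norm_bounded hsum (fun k => hb k w)
    change ∑' k, M⁻¹ ^ (k + 1) * (Subtype.val (cons z k)) = _
    rw [(h1 (cons z)).tsum_eq_zero_add, mul_add, ← tsum_mul_left, add_comm]
    congr 1
    · refine tsum_congr fun k => ?_
      change M⁻¹ ^ (k + 1 + 1) * (z.2 k : ℝ) = _
      ring
    · change M⁻¹ ^ (0 + 1) * (z.1 : ℝ) = _
      ring
  refine ⟨P.map S, ?_, ?_, ?_⟩
  · exact Measure.isProbabilityMeasure_map hSm.aemeasurable
  · refine ⟨Set.range S, isCompact_range hS, ?_⟩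
    rw [Measure.map_apply hSm (isCompact_range hS).isClosed.measurableSet.compl]
    convert measure_empty (μ := P)
    ext w
    simp
  · intro E hE
    rw [Measure.map_apply hSm hE]
    have hP : P = (ν.prod P).map cons := (infinitePi_map_cons ν).symm
    conv_lhs => rw [hP]
    rw [Measure.map_apply hcons (hSm hE), Measure.prod_apply (hcons (hSm hE)),
      lintegral_smul_measure, lintegral_count, tsum_fintype, smul_eq_mul,
      ← Finset.sum_coe_sort D]
    congr 1
    refine Finset.sum_congr rfl fun d _ => ?_
    rw [Measure.map_apply hSm (by measurability)]
    congr 1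
    ext w
    simp [hScons]

/-- For `M > 1` and a nonempty digit set, `selfSimilarMeasure M D` is the unique compactly supported
Borel probability measure satisfying the self-similarity relation. -/
theorem isSelfSimilarMeasure_iff {M : ℝ} (hM : 1 < M) {D : Finset ℝ} (hD : D.Nonempty)
    {μ : Measure ℝ} : IsSelfSimilarMeasure M D μ ↔ μ = selfSimilarMeasure M D := by
  have h := exists_isSelfSimilarMeasure hM hD
  have hs : IsSelfSimilarMeasure M D (selfSimilarMeasure M D) := by
    rw [selfSimilarMeasure, dif_pos h]
    exact h.choose_spec
  exact ⟨fun hμ => hμ.unique hM hD hs, fun hμ => hμ ▸ hs⟩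

/-- The set `w₀{0,…,N-1} ⊕ w₁{0,…,N-1} ⊕ ⋯`, the sum running over the weights `w i`. -/
def weightedDigitSum (N : ℕ) {n : ℕ} (w : Fin n → ℝ) : Finset ℝ :=
  Finset.univ.image fun a : Fin n → Fin N => ∑ i, w i * ((a i : ℕ) : ℝ)

/-- The exponents `0, p₁, …, p_s`. -/
def exponents {s : ℕ} (p : Fin s → ℕ) : Fin (s + 1) → ℕ := Fin.cons 0 p

/-- `D = {0,…,N-1} ⊕ N^{p₁}{0,…,N-1} ⊕ ⋯ ⊕ N^{p_s}{0,…,N-1}`. -/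
def digitSet (N : ℕ) {s : ℕ} (p : Fin s → ℕ) : Finset ℝ :=
  weightedDigitSum N fun i => (N : ℝ) ^ exponents p i

/-- `L = R N^q (N⁻¹{0,…,N-1} ⊕ N^{-(p₁+1)}{0,…,N-1} ⊕ ⋯ ⊕ N^{-(p_s+1)}{0,…,N-1})`. -/
def spectrumDigitSet (R N q : ℕ) {s : ℕ} (p : Fin s → ℕ) : Finset ℝ :=
  (weightedDigitSum N fun i => 1 / (N : ℝ) ^ (exponents p i + 1)).image
    fun x => (R : ℝ) * (N : ℝ) ^ q * x

/-- `{∑_{j=1}^{k} M^{j-1} l_j : k ≥ 1, l_j ∈ L}`; here `j` runs from `0` to `k - 1`. -/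
def finiteExpansions (M : ℝ) (L : Finset ℝ) : Set ℝ :=
  {x | ∃ k : ℕ, 1 ≤ k ∧ ∃ l : Fin k → ℝ, (∀ j, l j ∈ L) ∧ x = ∑ j : Fin k, M ^ (j : ℕ) * l j}

end

/-! Let `m` be the mask of `D`, the average of `e^{2πidx}` over `d ∈ D`, and `μ̂(x) = charFun μ
(2πx)`. Self-similarity gives `μ̂(x) = m(x/M) ⋯ m(x/Mⁿ) μ̂(x/Mⁿ)`; call the product of masks
`m_n(x)`. The arithmetic input is that `(M, D, L)` is a Hadamard triple
(`isHadamardTriple_productDigit`): `m` is a product of geometric-sum masks, and for distinct `l, l'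
∈ L` the factor at the largest differing index vanishes at `(l' - l)/M`. Unitarity then yields `∑
|m_n(t + λ)|² = 1` over the values `λ` of words of length `n`
(`IsHadamardTriple.sum_norm_levelMask_sq`), and with it orthogonality. For completeness it suffices
that `∑_{λ ∈ Λ} |μ̂(t + λ)|² = 1` for all `t`: this is Parseval's equality for every exponential,
and exponentials are total in `L²(μ)`. The identity is the limit `n → ∞` of the finite one
(`IsHadamardTriple.tsum_norm_charFun_sq`). Domination holds because `(t + λ)/Mⁿ` stays in `[-3/2,
3/2]`, where `R ≥ 2` keeps `μ̂` away from zero. -/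

/-- The character `x ↦ e^{2πix}` of the real line. -/
noncomputable def unitExp (x : ℝ) : ℂ := Complex.exp (2 * Real.pi * Complex.I * (x : ℂ))

theorem unitExp_add (x y : ℝ) : unitExp (x + y) = unitExp x * unitExp y := by
  simp only [unitExp, ← Complex.exp_add]
  congr 1
  push_cast
  ring

@[simp] theorem unitExp_zero : unitExp 0 = 1 := by simp [unitExp]

theorem unitExp_eq_exp_mul_I (x : ℝ) :
    unitExp x = Complex.exp (((2 * Real.pi * x : ℝ) : ℂ) * Complex.I) := by
  rw [unitExp]
  congr 1
  push_cast
  ring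

@[simp] theorem norm_unitExp (x : ℝ) : ‖unitExp x‖ = 1 := by
  rw [unitExp_eq_exp_mul_I, Complex.norm_exp_ofReal_mul_I]

theorem star_unitExp (x : ℝ) : star (unitExp x) = unitExp (-x) := by
  simp only [unitExp, Complex.star_def, ← Complex.exp_conj]
  congr 1
  simp [Complex.conj_ofNat]

theorem unitExp_eq_one_iff {x : ℝ} : unitExp x = 1 ↔ ∃ n : ℤ, x = n := by
  rw [unitExp, Complex.exp_eq_one_iff]
  refine exists_congr fun n => ?_
  rw [mul_comm (n : ℂ), mul_right_inj' Complex.two_pi_I_ne_zero]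
  norm_cast

@[simp] theorem unitExp_intCast (n : ℤ) : unitExp n = 1 := unitExp_eq_one_iff.2 ⟨n, rfl⟩

theorem unitExp_natCast_mul (n : ℕ) (x : ℝ) : unitExp (n * x) = unitExp x ^ n := by
  rw [unitExp, unitExp, ← Complex.exp_nat_mul]
  congr 1
  push_cast
  ring

theorem continuous_unitExp : Continuous unitExp := by
  unfold unitExp
  fun_prop

/-! ### Base-`M` words over the dual digits -/

/-- The value `∑_j M^j l(w_j)` of a word of digits. -/
def wordVal {ι : Type*} (M : ℕ) (l : ι → ℤ) {n : ℕ} (w : Fin n → ι) : ℤ :=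
  ∑ j : Fin n, (M : ℤ) ^ (j : ℕ) * l (w j)

theorem wordVal_cons {ι : Type*} (M : ℕ) (l : ι → ℤ) {n : ℕ} (a : ι) (w : Fin n → ι) :
    wordVal M l (Fin.cons a w : Fin (n + 1) → ι) = l a + M * wordVal M l w := by
  simp [wordVal, Fin.sum_univ_succ, Finset.mul_sum, pow_succ', mul_assoc]

theorem wordVal_snoc {ι : Type*} (M : ℕ) (l : ι → ℤ) {n : ℕ} (w : Fin n → ι) (a : ι) :
    wordVal M l (Fin.snoc w a : Fin (n + 1) → ι) = wordVal M l w + M ^ n * l a := by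
  simp [wordVal, Fin.sum_univ_castSucc]

theorem wordVal_nonneg {ι : Type*} {M : ℕ} {l : ι → ℤ} (hl : ∀ a, 0 ≤ l a) {n : ℕ} (w : Fin n → ι) :
    0 ≤ wordVal M l w :=
  Finset.sum_nonneg fun j _ => mul_nonneg (by positivity) (hl _)

theorem wordVal_lt {ι : Type*} {M : ℕ} {l : ι → ℤ} (hl : ∀ a, l a < M) {n : ℕ} (w : Fin n → ι) :
    wordVal M l w < M ^ n := by
  induction n with
  | zero => simp [wordVal]
  | succ n ih =>
    rw [← Fin.snoc_init_self w, wordVal_snoc]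
    have h1 := ih (Fin.init w)
    have h2 : (M : ℤ) ^ n * l (w (Fin.last n)) ≤ M ^ n * (M - 1) :=
      mul_le_mul_of_nonneg_left (by linarith [Int.add_one_le_iff.2 (hl (w (Fin.last n)))])
        (by positivity)
    rw [pow_succ]
    linarith

/-! ### Masks and Hadamard triples -/

section Mask

variable {ι : Type*} [Fintype ι]

/-- The mask function of the family of integer digits `d`. -/
noncomputable def mask (d : ι → ℤ) (x : ℝ) : ℂ := (Fintype.card ι : ℂ)⁻¹ * ∑ i, unitExp (d i * x)

theorem mask_add_intCast (d : ι → ℤ) (x : ℝ) (n : ℤ) : mask d (x + n) = mask d x := by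
  unfold mask
  congr 1
  refine Finset.sum_congr rfl fun i _ => ?_
  rw [mul_add, unitExp_add, ← Int.cast_mul, unitExp_intCast, mul_one]

theorem mask_zero [Nonempty ι] (d : ι → ℤ) : mask d 0 = 1 := by
  simp [mask]

/-- `(M, d, l)` is a Hadamard triple: the exponential matrix of `d / M` and `l` has pairwise
orthogonal columns. -/
def IsHadamardTriple (M : ℕ) (d l : ι → ℤ) : Prop :=
  ∀ a b, a ≠ b → mask d ((l b - l a) / M) = 0

open Matrix in
-- The hypothesis is column orthogonality; for a square matrix a left inverse is a right inverse, so
-- the rows are orthogonal too.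
theorem IsHadamardTriple.mul_conjTranspose [DecidableEq ι] [Nonempty ι] {M : ℕ} {d l : ι → ℤ}
    (h : IsHadamardTriple M d l) :
    (Matrix.of fun i b : ι => unitExp (d i * (l b / M))) *
      (Matrix.of fun i b : ι => unitExp (d i * (l b / M)))ᴴ =
        (Fintype.card ι : ℂ) • (1 : Matrix ι ι ℂ) := by
  set U : Matrix ι ι ℂ := Matrix.of fun i b : ι => unitExp (d i * (l b / M)) with hU
  have hc : (Fintype.card ι : ℂ) ≠ 0 := by exact_mod_cast Fintype.card_ne_zero
  have key : ((Fintype.card ι : ℂ)⁻¹ • Uᴴ) * U = 1 := by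
    ext a b
    have e : ((((Fintype.card ι : ℂ)⁻¹ • Uᴴ) * U) a b) = mask d ((l b - l a) / M) := by
      rw [Matrix.smul_mul]
      simp only [mask, Matrix.smul_apply, Matrix.mul_apply, conjTranspose_apply,
        smul_eq_mul, hU, Matrix.of_apply, star_unitExp, ← unitExp_add]
      congr 1
      refine Finset.sum_congr rfl fun i _ => ?_
      congr 1
      ring
    rw [e]
    by_cases hab : a = b
    · subst hab
      simp [mask_zero]
    · rw [h a b hab, Matrix.one_apply_ne hab]
  have k2 := mul_eq_one_comm.1 key
  rw [Matrix.mul_smul] at k2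
  rw [← k2, smul_smul, mul_inv_cancel₀ hc, one_smul]

/-- Equal digits would give two equal rows, whose inner product is both `0` and the number of
digits. -/
theorem IsHadamardTriple.injective [Nonempty ι] {M : ℕ} {d l : ι → ℤ}
    (h : IsHadamardTriple M d l) : Function.Injective d := by
  classical
  intro i j hij
  by_contra hne
  have hc : (Fintype.card ι : ℂ) ≠ 0 := by exact_mod_cast Fintype.card_ne_zero
  have h1 := congrFun (congrFun h.mul_conjTranspose i) j
  have h2 := congrFun (congrFun h.mul_conjTranspose i) i
  rw [Matrix.smul_apply, Matrix.one_apply_ne hne] at h1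
  rw [Matrix.smul_apply, Matrix.one_apply_eq] at h2
  simp only [Matrix.mul_apply, Matrix.conjTranspose_apply, Matrix.of_apply, ← hij] at h1 h2
  rw [h1, smul_zero, smul_eq_mul, mul_one] at h2
  exact hc h2.symm

open Matrix in
-- Up to the factor `1/#ι`, the mask values are the entries of `c ᵥ* U` with `c` unimodular, and `U`
-- scales squared norms by `#ι`.
theorem IsHadamardTriple.sum_norm_mask_sq [Nonempty ι] {M : ℕ} {d l : ι → ℤ}
    (h : IsHadamardTriple M d l) (x : ℝ) : ∑ b, ‖mask d (x + l b / M)‖ ^ 2 = 1 := by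
  classical
  have hc : (Fintype.card ι : ℂ) ≠ 0 := by exact_mod_cast Fintype.card_ne_zero
  have hU := h.mul_conjTranspose
  set U : Matrix ι ι ℂ := Matrix.of fun i b : ι => unitExp (d i * (l b / M)) with hUdef
  let c : ι → ℂ := fun i => unitExp (d i * x)
  have e : ∀ b, mask d (x + l b / M) = (Fintype.card ι : ℂ)⁻¹ * (c ᵥ* U) b := by
    intro b
    simp [mask, vecMul, dotProduct, c, hUdef, ← unitExp_add, mul_add]
  have e2 : (c ᵥ* U) ⬝ᵥ star (c ᵥ* U) = (Fintype.card ι : ℂ) * Fintype.card ι := by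
    rw [star_vecMul, ← dotProduct_mulVec, mulVec_mulVec, hU, smul_mulVec, one_mulVec,
      dotProduct_smul, smul_eq_mul]
    congr 1
    simp [dotProduct, c, RCLike.mul_conj]
  have e3 : ∑ b, ‖(c ᵥ* U) b‖ ^ 2 = (Fintype.card ι : ℝ) * Fintype.card ι := by
    have : ((∑ b, ‖(c ᵥ* U) b‖ ^ 2 : ℝ) : ℂ) = (Fintype.card ι : ℂ) * Fintype.card ι := by
      rw [← e2]
      simp [dotProduct, RCLike.mul_conj]
    exact_mod_cast this
  have hc' : (Fintype.card ι : ℝ) ≠ 0 := by exact_mod_cast hc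
  simp only [e, norm_mul, mul_pow, ← Finset.mul_sum, e3, norm_inv, Complex.norm_natCast]
  field_simp

/-- The product `∏_{k = 1}^{n} m(x / M^k)` of dilated masks. -/
noncomputable def levelMask (M : ℕ) (d : ι → ℤ) : ℕ → ℝ → ℂ
  | 0, _ => 1
  | n + 1, x => mask d (x / M) * levelMask M d n (x / M)

theorem levelMask_zero_right [Nonempty ι] (M : ℕ) (d : ι → ℤ) (n : ℕ) :
    levelMask M d n 0 = 1 := by
  induction n with
  | zero => rfl
  | succ n ih => simp [levelMask, ih, mask_zero]

/-- Split off the lowest letter `a`: the rest of the word shifts the argument of the outer mask by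
an integer, so that factor depends on `a` alone. -/
theorem IsHadamardTriple.sum_norm_levelMask_sq [Nonempty ι] {M : ℕ} (hM : 0 < M) {d l : ι → ℤ}
    (h : IsHadamardTriple M d l) (n : ℕ) (x : ℝ) :
    ∑ w : Fin n → ι, ‖levelMask M d n (x + wordVal M l w)‖ ^ 2 = 1 := by
  have hM' : (M : ℝ) ≠ 0 := by exact_mod_cast hM.ne'
  induction n generalizing x with
  | zero => simp [levelMask]
  | succ n ih =>
    rw [← (Fin.consEquiv fun _ : Fin (n + 1) => ι).sum_comp, Fintype.sum_prod_type,
      ← h.sum_norm_mask_sq (x / M)]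
    refine Finset.sum_congr rfl fun a _ => ?_
    have e : ∀ w : Fin n → ι,
        (x + wordVal M l ((Fin.consEquiv fun _ : Fin (n + 1) => ι) (a, w)) : ℝ) / M =
          (x / M + l a / M) + wordVal M l w := by
      intro w
      have := wordVal_cons M l a w
      simp only [Fin.consEquiv, Equiv.coe_fn_mk]
      rw [this]
      push_cast
      field_simp
      ring
    simp only [levelMask, e, mask_add_intCast, norm_mul, mul_pow]
    rw [← Finset.mul_sum, ih, mul_one]

/-- In the sum identity at minus the value of `w`, the term of `w` is already `1`, so all others
vanish. -/
theorem IsHadamardTriple.levelMask_sub_eq_zero [Nonempty ι] {M : ℕ} (hM : 0 < M) {d l : ι → ℤ}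
    (h : IsHadamardTriple M d l) {n : ℕ} {v w : Fin n → ι} (hvw : v ≠ w) :
    levelMask M d n (wordVal M l v - wordVal M l w) = 0 := by
  classical
  have h1 := h.sum_norm_levelMask_sq hM n (-wordVal M l w)
  rw [← Finset.add_sum_erase _ _ (Finset.mem_univ w), neg_add_cancel, levelMask_zero_right,
    norm_one, one_pow, add_eq_left, Finset.sum_eq_zero_iff_of_nonneg fun _ _ => sq_nonneg _] at h1
  have h2 := h1 v (by simp [hvw])
  rwa [sq_eq_zero_iff, norm_eq_zero, neg_add_eq_sub] at h2

theorem IsHadamardTriple.wordVal_injective [Nonempty ι] {M : ℕ} (hM : 0 < M) {d l : ι → ℤ}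
    (h : IsHadamardTriple M d l) (n : ℕ) :
    Function.Injective (wordVal M l : (Fin n → ι) → ℤ) := by
  intro v w hvw
  by_contra hne
  have := h.levelMask_sub_eq_zero hM hne
  rw [hvw, sub_self, levelMask_zero_right] at this
  exact one_ne_zero this

end Mask

/-! ### Parseval's equality and uniqueness of the Fourier transform -/

/-- Equality in Bessel puts `x` in the closed span. Concretely, `f` sees only the residual of `x`
after a partial expansion, whose norm tends to `0`; conclude by Cauchy–Schwarz. -/
theorem Orthonormal.inner_eq_zero_of_one_le_tsum {E ι : Type*} [NormedAddCommGroup E]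
    [InnerProductSpace ℂ E] {v : ι → E} (hv : Orthonormal ℂ v) {x : E}
    (hx : ‖x‖ ^ 2 ≤ ∑' i, ‖inner ℂ (v i) x‖ ^ 2) {f : E} (hf : ∀ i, inner ℂ f (v i) = 0) :
    inner ℂ f x = 0 := by
  have hb : ∀ s : Finset ι, ‖inner ℂ f x‖ ^ 2 ≤
      ‖f‖ ^ 2 * (‖x‖ ^ 2 - ∑ i ∈ s, ‖inner ℂ (v i) x‖ ^ 2) := by
    intro s
    set y : E := x - ∑ i ∈ s, inner ℂ (v i) x • v i with hy
    have h1 : inner ℂ f x = inner ℂ f y := by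
      simp [hy, hf]
    have h2 : inner ℂ y (∑ i ∈ s, inner ℂ (v i) x • v i) = 0 := by
      classical
      rw [inner_sum]
      refine Finset.sum_eq_zero fun i hi => ?_
      rw [inner_smul_right, hy, inner_sub_left, hv.inner_left_sum _ hi, inner_conj_symm, sub_self,
        mul_zero]
    have h3 : ‖x‖ ^ 2 = ‖y‖ ^ 2 + ∑ i ∈ s, ‖inner ℂ (v i) x‖ ^ 2 := by
      have e : x = y + ∑ i ∈ s, inner ℂ (v i) x • v i := by simp [hy]
      have e2 : ‖∑ i ∈ s, inner ℂ (v i) x • v i‖ ^ 2 = ∑ i ∈ s, ‖inner ℂ (v i) x‖ ^ 2 := by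
        rw [@norm_sq_eq_re_inner ℂ, hv.inner_sum]
        simp only [RCLike.conj_mul, map_sum]
        refine Finset.sum_congr rfl fun i _ => ?_
        norm_cast
      rw [← e2]
      conv_lhs => rw [e]
      simp only [sq]
      exact norm_add_sq_eq_norm_sq_add_norm_sq_of_inner_eq_zero _ _ h2
    rw [h1, h3, add_sub_cancel_right, ← mul_pow]
    exact pow_le_pow_left₀ (norm_nonneg _) (norm_inner_le_norm _ _) 2
  have hs := (hv.inner_products_summable x).hasSum
  have hlim : Filter.Tendsto
      (fun s : Finset ι => ‖f‖ ^ 2 * (‖x‖ ^ 2 - ∑ i ∈ s, ‖inner ℂ (v i) x‖ ^ 2)) Filter.atTop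
      (𝓝 (‖f‖ ^ 2 * (‖x‖ ^ 2 - ∑' i, ‖inner ℂ (v i) x‖ ^ 2))) :=
    (tendsto_const_nhds.sub hs).const_mul _
  have h4 := ge_of_tendsto' hlim hb
  have h5 : ‖inner ℂ f x‖ ^ 2 ≤ 0 :=
    h4.trans (mul_nonpos_of_nonneg_of_nonpos (sq_nonneg _) (sub_nonpos.2 hx))
  simpa using le_antisymm h5 (sq_nonneg _)

/-- Uniqueness of the Fourier transform for real integrable functions. -/
theorem ae_eq_zero_of_integral_exp_mul_eq_zero_real {μ : Measure ℝ} [IsFiniteMeasure μ]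
    {g : ℝ → ℝ} (hg : Integrable g μ)
    (h : ∀ t : ℝ, ∫ x, Complex.exp (t * x * Complex.I) * (g x : ℂ) ∂μ = 0) : g =ᵐ[μ] 0 := by
  wlog hm : Measurable g generalizing g
  · have hae := hg.aestronglyMeasurable.ae_eq_mk
    have := this (g := hg.aestronglyMeasurable.mk g) (hg.congr hae) (fun t => by
      rw [← h t]
      refine integral_congr_ae ?_
      filter_upwards [hae] with x hx
      rw [hx]) hg.aestronglyMeasurable.stronglyMeasurable_mk.measurable
    exact hae.trans this
  -- `ofReal` truncates at zero, so `ν g` and `ν (-g)` carry the positive and negative parts of `g`;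
  -- the hypothesis says that their characteristic functions agree.
  let ν : (ℝ → ℝ) → Measure ℝ := fun g => μ.withDensity fun x => ENNReal.ofReal (g x)
  have hcf : ∀ {g : ℝ → ℝ}, Measurable g → ∀ t : ℝ, charFun (ν g) t =
      ∫ x, Complex.exp (t * x * Complex.I) * ((max (g x) 0 : ℝ) : ℂ) ∂μ := by
    intro g hm t
    rw [charFun_apply_real, integral_withDensity_eq_integral_toReal_smul (by fun_prop) (by simp)]
    refine integral_congr_ae (Filter.Eventually.of_forall fun x => ?_)
    simp [ENNReal.toReal_ofReal', Complex.real_smul, mul_comm]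
  have hint : ∀ {g : ℝ → ℝ}, Integrable g μ → ∀ t : ℝ,
      Integrable (fun x : ℝ => Complex.exp (t * x * Complex.I) * ((max (g x) 0 : ℝ) : ℂ)) μ := by
    intro g hg t
    refine (hg.pos_part.ofReal (𝕜 := ℂ)).bdd_mul (c := 1) (by fun_prop)
      (Filter.Eventually.of_forall fun x => ?_)
    rw [← Complex.ofReal_mul, Complex.norm_exp_ofReal_mul_I]
  have hfin : ∀ {g : ℝ → ℝ}, Integrable g μ → IsFiniteMeasure (ν g) := fun hg =>
    isFiniteMeasure_withDensity_ofReal hg.2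
  have h1 := hfin hg
  have h2 := hfin hg.neg
  have key : ν g = ν (-g) := by
    refine Measure.ext_of_charFun (funext fun t => ?_)
    rw [hcf hm, hcf hm.neg, ← sub_eq_zero, ← integral_sub (hint hg t) (hint hg.neg t), ← h t]
    refine integral_congr_ae (Filter.Eventually.of_forall fun x => ?_)
    simp only [Pi.neg_apply]
    rw [← mul_sub, ← Complex.ofReal_sub]
    congr 2
    exact max_zero_sub_max_neg_zero_eq_self (g x)
  have h3 := (withDensity_eq_iff (by fun_prop) (by fun_prop) hg.lintegral_lt_top.ne).1 key
  filter_upwards [h3] with x hx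
  have h4 := congrArg ENNReal.toReal hx
  simp only [ENNReal.toReal_ofReal', Pi.neg_apply] at h4
  have := max_zero_sub_max_neg_zero_eq_self (g x)
  rw [h4, sub_self] at this
  simpa using this.symm

/-- Uniqueness of the Fourier transform for complex integrable functions. -/
theorem ae_eq_zero_of_integral_exp_mul_eq_zero {μ : Measure ℝ} [IsFiniteMeasure μ]
    {f : ℝ → ℂ} (hf : Integrable f μ)
    (h : ∀ t : ℝ, ∫ x, Complex.exp (t * x * Complex.I) * f x ∂μ = 0) : f =ᵐ[μ] 0 := by
  have hint : ∀ {f : ℝ → ℂ}, Integrable f μ → ∀ t : ℝ,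
      Integrable (fun x : ℝ => Complex.exp (t * x * Complex.I) * f x) μ := by
    intro f hf t
    refine hf.bdd_mul (c := 1) (by fun_prop) (Filter.Eventually.of_forall fun x => ?_)
    rw [← Complex.ofReal_mul, Complex.norm_exp_ofReal_mul_I]
  -- Conjugating the hypothesis at `-t` handles the conjugate of `f`, hence its real and imaginary
  -- parts.
  have hconj : ∀ t : ℝ,
      ∫ x, Complex.exp (t * x * Complex.I) * (starRingEnd ℂ) (f x) ∂μ = 0 := by
    intro t
    have := congrArg (starRingEnd ℂ) (h (-t))
    rw [← integral_conj, map_zero] at this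
    rw [← this]
    refine integral_congr_ae (Filter.Eventually.of_forall fun x => ?_)
    simp [← Complex.exp_conj]
  have hfc : Integrable (fun x => (starRingEnd ℂ) (f x)) μ :=
    (LinearIsometryEquiv.integrable_comp_iff Complex.conjLIE).2 hf
  have hre : (fun x => (f x).re) =ᵐ[μ] 0 := by
    refine ae_eq_zero_of_integral_exp_mul_eq_zero_real hf.re fun t => ?_
    have e : ∀ x : ℝ, Complex.exp (t * x * Complex.I) * ((f x).re : ℂ) =
        (Complex.exp (t * x * Complex.I) * f x +
          Complex.exp (t * x * Complex.I) * (starRingEnd ℂ) (f x)) * (1 / 2) := by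
      intro x
      rw [Complex.re_eq_add_conj]
      ring
    simp only [e]
    rw [integral_mul_const, integral_add (hint hf t) (hint hfc t), h, hconj]
    simp
  have him : (fun x => (f x).im) =ᵐ[μ] 0 := by
    refine ae_eq_zero_of_integral_exp_mul_eq_zero_real hf.im fun t => ?_
    have e : ∀ x : ℝ, Complex.exp (t * x * Complex.I) * ((f x).im : ℂ) =
        (Complex.exp (t * x * Complex.I) * f x -
          Complex.exp (t * x * Complex.I) * (starRingEnd ℂ) (f x)) * (1 / (2 * Complex.I)) := by
      intro x
      rw [Complex.im_eq_sub_conj]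
      ring
    simp only [e]
    rw [integral_mul_const, integral_sub (hint hf t) (hint hfc t), h, hconj]
    simp
  filter_upwards [hre, him] with x h1 h2
  exact Complex.ext h1 h2

/-! ### Exponentials in `L²(μ)` -/

theorem memLp_unitExp_mul (μ : Measure ℝ) [IsFiniteMeasure μ] (y : ℝ) :
    MemLp (fun x : ℝ => unitExp (y * x)) 2 μ :=
  MemLp.of_bound (continuous_unitExp.comp (by fun_prop)).aestronglyMeasurable 1
    (Filter.Eventually.of_forall fun x => by simp)

/-- The exponential `x ↦ e^{2πiyx}` as an element of `L²(μ)`. -/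
noncomputable def expLp (μ : Measure ℝ) [IsFiniteMeasure μ] (y : ℝ) : Lp ℂ 2 μ :=
  (memLp_unitExp_mul μ y).toLp _

theorem coeFn_expLp (μ : Measure ℝ) [IsFiniteMeasure μ] (y : ℝ) :
    ⇑(expLp μ y) =ᵐ[μ] fun x => unitExp (y * x) :=
  (memLp_unitExp_mul μ y).coeFn_toLp

theorem inner_expLp (μ : Measure ℝ) [IsFiniteMeasure μ] (x y : ℝ) :
    inner ℂ (expLp μ x) (expLp μ y) = charFun μ (2 * Real.pi * (y - x)) := by
  rw [L2.inner_def, charFun_apply_real]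
  refine integral_congr_ae ?_
  filter_upwards [coeFn_expLp μ x, coeFn_expLp μ y] with z hx hy
  rw [hx, hy, RCLike.inner_apply, ← Complex.star_def, star_unitExp, ← unitExp_add,
    unitExp_eq_exp_mul_I]
  congr 1
  push_cast
  ring

theorem norm_expLp (μ : Measure ℝ) [IsProbabilityMeasure μ] (y : ℝ) : ‖expLp μ y‖ = 1 := by
  have h : ‖expLp μ y‖ ^ 2 = 1 := by
    rw [@norm_sq_eq_re_inner ℂ, inner_expLp]
    simp
  exact (pow_eq_one_iff_of_nonneg (norm_nonneg _) two_ne_zero).1 h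

theorem eq_zero_of_forall_inner_expLp_eq_zero (μ : Measure ℝ) [IsFiniteMeasure μ] {f : Lp ℂ 2 μ}
    (h : ∀ y, inner ℂ (expLp μ y) f = 0) : f = 0 := by
  have hf : Integrable f μ := (Lp.memLp f).integrable (by norm_num)
  rw [Lp.eq_zero_iff_ae_eq_zero]
  refine ae_eq_zero_of_integral_exp_mul_eq_zero hf fun t => ?_
  rw [← h (-t / (2 * Real.pi)), L2.inner_def]
  refine integral_congr_ae ?_
  filter_upwards [coeFn_expLp μ (-t / (2 * Real.pi))] with x hx
  rw [hx, RCLike.inner_apply, ← Complex.star_def, star_unitExp, unitExp_eq_exp_mul_I, mul_comm]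
  congr 3
  have := Real.pi_ne_zero
  rw [← Complex.ofReal_mul]
  congr 1
  field_simp

/-! ### From a Hadamard triple to a spectrum -/

section Spectrum

variable {ι : Type*} [Fintype ι] {M : ℕ} {d l : ι → ℤ} {μ : Measure ℝ}

theorem IsSelfSimilarMeasure.charFun_two_pi_mul (hd : Function.Injective d)
    (hμ : IsSelfSimilarMeasure M (Finset.univ.image fun i => (d i : ℝ)) μ) (x : ℝ) :
    charFun μ (2 * Real.pi * x) = mask d (x / M) * charFun μ (2 * Real.pi * (x / M)) := by
  have hd' : Function.Injective fun i => (d i : ℝ) := Int.cast_injective.comp hd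
  rw [hμ.charFun_eq, Finset.card_image_of_injective _ hd', Finset.sum_image hd'.injOn, mask,
    Finset.card_univ]
  congr 2
  · refine Finset.sum_congr rfl fun i _ => ?_
    rw [unitExp_eq_exp_mul_I]
    congr 3
    ring
  · ring

theorem IsSelfSimilarMeasure.charFun_eq_levelMask_mul (hd : Function.Injective d)
    (hμ : IsSelfSimilarMeasure M (Finset.univ.image fun i => (d i : ℝ)) μ) (n : ℕ) (x : ℝ) :
    charFun μ (2 * Real.pi * x) =
      levelMask M d n x * charFun μ (2 * Real.pi * (x / M ^ n)) := by
  induction n generalizing x with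
  | zero => simp [levelMask]
  | succ n ih =>
    rw [hμ.charFun_two_pi_mul hd, ih, levelMask, div_div, ← pow_succ', ← mul_assoc (mask _ _)]

theorem tendsto_div_natCast_pow (hM : 1 < M) (x : ℝ) :
    Filter.Tendsto (fun n : ℕ => x / (M : ℝ) ^ n) Filter.atTop (𝓝 0) :=
  tendsto_const_nhds.div_atTop (tendsto_pow_atTop_atTop_of_one_lt (by exact_mod_cast hM))

theorem tendsto_charFun_div_pow [IsProbabilityMeasure μ] (hM : 1 < M) (x : ℝ) :
    Filter.Tendsto (fun n : ℕ => charFun μ (2 * Real.pi * (x / (M : ℝ) ^ n))) Filter.atTop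
      (𝓝 1) := by
  have h1 := (tendsto_div_natCast_pow hM x).const_mul (2 * Real.pi)
  have h2 := ((continuous_charFun (μ := μ)).tendsto _).comp h1
  simpa [Function.comp_def] using h2

/-- Division by `M` sends `|x| < 2` into the zero-free region `|x| < 2/M`, which lies in `|x| < 2`
again. -/
theorem levelMask_ne_zero (hM : 1 < M) (hnz : ∀ x : ℝ, |x| < 2 / M → mask d x ≠ 0) (n : ℕ)
    {x : ℝ} (hx : |x| < 2) : levelMask M d n x ≠ 0 := by
  have hM' : (1 : ℝ) < M := by exact_mod_cast hM
  induction n generalizing x with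
  | zero => simp [levelMask]
  | succ n ih =>
    have h1 : |x / M| < 2 / M := by
      rw [abs_div, Nat.abs_cast]
      gcongr
    exact mul_ne_zero (hnz _ h1) (ih (h1.trans (div_lt_self two_pos hM')))

/-- No infinite product is needed: for some `n` the remaining factor, near `μ̂(0) = 1`, is nonzero.
-/
theorem IsSelfSimilarMeasure.charFun_ne_zero (hM : 1 < M) (hd : Function.Injective d)
    (hnz : ∀ x : ℝ, |x| < 2 / M → mask d x ≠ 0)
    (hμ : IsSelfSimilarMeasure M (Finset.univ.image fun i => (d i : ℝ)) μ) {x : ℝ}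
    (hx : |x| < 2) : charFun μ (2 * Real.pi * x) ≠ 0 := by
  have := hμ.isProbabilityMeasure
  obtain ⟨n, hn⟩ := ((tendsto_charFun_div_pow (μ := μ) hM x).eventually_ne one_ne_zero).exists
  rw [hμ.charFun_eq_levelMask_mul hd n]
  exact mul_ne_zero (levelMask_ne_zero hM hnz n hx) hn

theorem IsSelfSimilarMeasure.exists_le_norm_charFun (hM : 1 < M) (hd : Function.Injective d)
    (hnz : ∀ x : ℝ, |x| < 2 / M → mask d x ≠ 0)
    (hμ : IsSelfSimilarMeasure M (Finset.univ.image fun i => (d i : ℝ)) μ) :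
    ∃ δ : ℝ, 0 < δ ∧ ∀ x : ℝ, |x| ≤ 3 / 2 → δ ≤ ‖charFun μ (2 * Real.pi * x)‖ := by
  have := hμ.isProbabilityMeasure
  have hc : Continuous fun x : ℝ => ‖charFun μ (2 * Real.pi * x)‖ :=
    ((continuous_charFun (μ := μ)).comp (by fun_prop)).norm
  obtain ⟨x, hx, hmin⟩ := (isCompact_Icc (a := (-(3 / 2) : ℝ)) (b := 3 / 2)).exists_isMinOn
    ⟨0, by norm_num⟩ hc.continuousOn
  refine ⟨_, norm_pos_iff.2 (hμ.charFun_ne_zero hM hd hnz (x := x) ?_), fun y hy => ?_⟩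
  · exact (abs_le.2 hx).trans_lt (by norm_num)
  · exact hmin (abs_le.1 hy)

theorem mem_finiteExpansions_image_iff {ι : Type*} [Fintype ι] {M : ℕ} {l : ι → ℤ} {x : ℝ} :
    x ∈ finiteExpansions M (Finset.univ.image fun a => (l a : ℝ)) ↔
      ∃ n, 1 ≤ n ∧ ∃ w : Fin n → ι, x = wordVal M l w := by
  constructor
  · rintro ⟨n, hn, v, hv, rfl⟩
    simp only [Finset.mem_image, Finset.mem_univ, true_and] at hv
    choose w hw using hv
    refine ⟨n, hn, w, ?_⟩
    simp [wordVal, hw]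
  · rintro ⟨n, hn, w, rfl⟩
    exact ⟨n, hn, fun j => l (w j), fun j => by simp, by simp [wordVal]⟩

/-- Padding with the zero digit at the top lets words be compared at a common length. -/
theorem exists_wordVal_eq_of_le {ι : Type*} {M : ℕ} {l : ι → ℤ} (h0 : ∃ a, l a = 0) {n m : ℕ}
    (hnm : n ≤ m) (w : Fin n → ι) : ∃ w' : Fin m → ι, wordVal M l w' = wordVal M l w := by
  obtain ⟨a, ha⟩ := h0
  induction m, hnm using Nat.le_induction with
  | base => exact ⟨w, rfl⟩
  | succ m _ ih =>
    obtain ⟨w', hw'⟩ := ih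
    exact ⟨Fin.snoc w' a, by rw [wordVal_snoc, ha, mul_zero, add_zero, hw']⟩

theorem IsHadamardTriple.orthonormal_expLp [Nonempty ι] (hM : 1 < M) (h : IsHadamardTriple M d l)
    (h0 : ∃ a, l a = 0) (hμ : IsSelfSimilarMeasure M (Finset.univ.image fun i => (d i : ℝ)) μ)
    [IsProbabilityMeasure μ] :
    Orthonormal ℂ fun x : finiteExpansions M (Finset.univ.image fun a => (l a : ℝ)) =>
      expLp μ x := by
  refine ⟨fun x => norm_expLp μ x, ?_⟩
  rintro ⟨x, hx⟩ ⟨y, hy⟩ hxy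
  obtain ⟨n, -, w, rfl⟩ := mem_finiteExpansions_image_iff.1 hx
  obtain ⟨m, -, v, rfl⟩ := mem_finiteExpansions_image_iff.1 hy
  obtain ⟨w', hw'⟩ := exists_wordVal_eq_of_le (M := M) h0 (le_max_left n m) w
  obtain ⟨v', hv'⟩ := exists_wordVal_eq_of_le (M := M) h0 (le_max_right n m) v
  rw [inner_expLp, hμ.charFun_eq_levelMask_mul h.injective (max n m)]
  simp only [← hw', ← hv'] at hxy ⊢
  rw [h.levelMask_sub_eq_zero (by lia), zero_mul]
  rintro rfl
  exact hxy rfl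

theorem IsHadamardTriple.tsum_norm_charFun_sq [Nonempty ι] (hM : 1 < M) (h : IsHadamardTriple M d l)
    (h0 : ∃ a, l a = 0) (hl0 : ∀ a, 0 ≤ l a) (hl : ∀ a, l a < M)
    (hnz : ∀ x : ℝ, |x| < 2 / M → mask d x ≠ 0)
    (hμ : IsSelfSimilarMeasure M (Finset.univ.image fun i => (d i : ℝ)) μ) (t : ℝ) :
    ∑' x : finiteExpansions M (Finset.univ.image fun a => (l a : ℝ)),
      ‖charFun μ (2 * Real.pi * (t + x))‖ ^ 2 = 1 := by
  classical
  have := hμ.isProbabilityMeasure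
  have hM0 : (0 : ℝ) < M := by exact_mod_cast (by lia : 0 < M)
  obtain ⟨δ, hδ, hδle⟩ := hμ.exists_le_norm_charFun hM h.injective hnz
  set Λ := finiteExpansions M (Finset.univ.image fun a => (l a : ℝ)) with hΛ
  let val : (n : ℕ) → (Fin n → ι) → ℝ := fun n w => wordVal M l w
  have hval : ∀ n, Function.Injective (val n) := fun n =>
    Int.cast_injective.comp (h.wordVal_injective (by lia) n)
  let W : ℕ → Finset ℝ := fun n => Finset.univ.image (val n)
  -- Extending by zero off the words of length `n` puts all levels on the same index set `Λ`.
  let F : ℕ → ℝ → ℝ := fun n x => if x ∈ W n then ‖levelMask M d n (t + x)‖ ^ 2 else 0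
  -- Bessel's inequality for the exponential of frequency `-t` supplies the dominating series.
  have hsum : Summable fun x : Λ => ‖charFun μ (2 * Real.pi * (t + x))‖ ^ 2 := by
    have := (h.orthonormal_expLp hM h0 hμ).inner_products_summable (expLp μ (-t))
    refine this.congr fun x => ?_
    rw [inner_expLp, ← norm_star, Complex.star_def, ← charFun_neg]
    congr 3
    ring
  have hlim : Filter.Tendsto (fun n => ∑' x : Λ, F n x) Filter.atTop
      (𝓝 (∑' x : Λ, ‖charFun μ (2 * Real.pi * (t + x))‖ ^ 2)) := by
    refine tendsto_tsum_of_dominated_convergence (hsum.mul_left (δ⁻¹ ^ 2)) ?_ ?_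
    · rintro ⟨x, hx⟩
      obtain ⟨n, -, w, rfl⟩ := mem_finiteExpansions_image_iff.1 hx
      have h1 : Filter.Tendsto
          (fun k => ‖levelMask M d k (t + wordVal M l w)‖ ^ 2) Filter.atTop
          (𝓝 (‖charFun μ (2 * Real.pi * (t + wordVal M l w))‖ ^ 2)) := by
        have h2 := tendsto_charFun_div_pow (μ := μ) hM (t + wordVal M l w)
        -- For large `k` the level mask is the quotient `μ̂(x) / μ̂(x/Mᵏ)`, whose denominator tends
        -- to `1`.
        have h3 : Filter.Tendsto (fun k : ℕ => charFun μ (2 * Real.pi * (t + wordVal M l w)) /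
            charFun μ (2 * Real.pi * ((t + wordVal M l w) / (M : ℝ) ^ k))) Filter.atTop
            (𝓝 (charFun μ (2 * Real.pi * (t + wordVal M l w)))) := by
          simpa [Pi.div_def] using tendsto_const_nhds.div h2 one_ne_zero
        refine Filter.Tendsto.congr' ?_ (h3.norm.pow 2)
        filter_upwards [h2.eventually_ne one_ne_zero] with k hk
        rw [hμ.charFun_eq_levelMask_mul h.injective k, mul_div_cancel_right₀ _ hk]
      refine h1.congr' ?_
      filter_upwards [Filter.eventually_ge_atTop n] with k hk
      obtain ⟨w', hw'⟩ := exists_wordVal_eq_of_le (M := M) h0 hk w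
      have : ((wordVal M l w : ℤ) : ℝ) ∈ W k :=
        Finset.mem_image.2 ⟨w', Finset.mem_univ _, by simp [val, hw']⟩
      simp only [F]
      rw [if_pos this]
    · have h1 : ∀ᶠ n : ℕ in Filter.atTop, |t / (M : ℝ) ^ n| < 1 / 2 := by
        have := (tendsto_div_natCast_pow hM t).abs
        rw [abs_zero] at this
        exact this.eventually_lt_const (by norm_num)
      filter_upwards [h1] with n hn
      rintro ⟨x, hx⟩
      simp only [F]
      split_ifs with hxW
      · obtain ⟨w, -, rfl⟩ := Finset.mem_image.1 hxW
        have hpow : (0 : ℝ) < (M : ℝ) ^ n := by positivity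
        have h2 : |(val n w) / (M : ℝ) ^ n| ≤ 1 := by
          have e1 : (0 : ℝ) ≤ (wordVal M l w : ℤ) := by exact_mod_cast wordVal_nonneg hl0 w
          have e2 : ((wordVal M l w : ℤ) : ℝ) < (M : ℝ) ^ n := by exact_mod_cast wordVal_lt hl w
          simp only [val]
          rw [abs_of_nonneg (by positivity), div_le_one hpow]
          exact e2.le
        -- Here `3/2` is `1/2` from `t` plus `1` from the word; then `|μ̂| ≥ δ` at this point bounds
        -- the level mask by `δ⁻¹ |μ̂(t + x)|`.
        have h3 : |(t + val n w) / (M : ℝ) ^ n| ≤ 3 / 2 := by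
          rw [add_div]
          linarith [abs_add_le (t / (M : ℝ) ^ n) (val n w / (M : ℝ) ^ n)]
        have h4 := hδle _ h3
        rw [Real.norm_of_nonneg (sq_nonneg _), ← mul_pow,
          hμ.charFun_eq_levelMask_mul h.injective n, norm_mul]
        refine pow_le_pow_left₀ (norm_nonneg _) ?_ 2
        rw [le_inv_mul_iff₀ hδ, mul_comm]
        exact mul_le_mul_of_nonneg_left h4 (norm_nonneg _)
      · simp only [norm_zero]
        positivity
  have hone : ∀ᶠ n in Filter.atTop, ∑' x : Λ, F n x = 1 := by
    filter_upwards [Filter.eventually_ge_atTop 1] with n hn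
    have hsub : ∀ x ∈ W n, x ∈ Λ := by
      intro x hx
      obtain ⟨w, -, rfl⟩ := Finset.mem_image.1 hx
      exact mem_finiteExpansions_image_iff.2 ⟨n, hn, w, rfl⟩
    rw [tsum_subtype Λ (F n), tsum_eq_sum (s := W n)]
    · rw [Finset.sum_image (hval n).injOn, ← h.sum_norm_levelMask_sq (by lia) n t]
      refine Finset.sum_congr rfl fun w _ => ?_
      have hw : val n w ∈ W n := Finset.mem_image_of_mem _ (Finset.mem_univ _)
      rw [Set.indicator_of_mem (hsub _ hw)]
      simp only [F]
      rw [if_pos hw]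
    · intro x hx
      simp [Set.indicator_apply, F, hx]
  exact tendsto_nhds_unique hlim (tendsto_const_nhds.congr' (hone.mono fun n hn => hn.symm))

theorem IsHadamardTriple.isSpectrum [Nonempty ι] (hM : 1 < M) (h : IsHadamardTriple M d l)
    (h0 : ∃ a, l a = 0) (hl0 : ∀ a, 0 ≤ l a) (hl : ∀ a, l a < M)
    (hnz : ∀ x : ℝ, |x| < 2 / M → mask d x ≠ 0)
    (hμ : IsSelfSimilarMeasure M (Finset.univ.image fun i => (d i : ℝ)) μ) :
    IsSpectrum μ (finiteExpansions M (Finset.univ.image fun a => (l a : ℝ))) := by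
  have := hμ.isProbabilityMeasure
  have hsub : finiteExpansions M (Finset.univ.image fun a => (l a : ℝ)) ⊆
      Set.range ((↑) : ℤ → ℝ) := by
    intro x hx
    obtain ⟨n, -, w, rfl⟩ := mem_finiteExpansions_image_iff.1 hx
    exact ⟨_, rfl⟩
  have hv := h.orthonormal_expLp hM h0 hμ
  refine ⟨(Set.countable_range _).mono hsub, ?_, ?_⟩
  · rw [← Set.image_univ] at hsub
    exact (IsDiscrete.univ.image Int.isClosedEmbedding_coe_real.isInducing).mono hsub
  · refine ⟨HilbertBasis.mkOfOrthogonalEqBot hv ?_, fun x => ?_⟩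
    · rw [Submodule.eq_bot_iff]
      intro f hf
      refine eq_zero_of_forall_inner_expLp_eq_zero μ fun y => ?_
      -- Parseval for the exponential of frequency `y` is the sum identity at `t = -y`.
      refine inner_eq_zero_symm.1 (hv.inner_eq_zero_of_one_le_tsum (x := expLp μ y) ?_ fun x => ?_)
      · rw [norm_expLp, one_pow, ← h.tsum_norm_charFun_sq hM h0 hl0 hl hnz hμ (-y)]
        refine le_of_eq (tsum_congr fun x => ?_)
        rw [inner_expLp, ← norm_star, Complex.star_def, ← charFun_neg]
        congr 3
        ring
      · exact Submodule.inner_left_of_mem_orthogonal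
          (Submodule.subset_span (Set.mem_range_self x)) hf
    · rw [HilbertBasis.coe_mkOfOrthogonalEqBot]
      filter_upwards [coeFn_expLp μ x] with z hz
      rw [hz, unitExp]
      congr 1
      push_cast
      ring

end Spectrum

/-! ### Zeros of the mask of consecutive digits -/

/-- The mask function of the digit set `{0, …, N - 1}`. -/
noncomputable def consecutiveMask (N : ℕ) (x : ℝ) : ℂ :=
  (N : ℂ)⁻¹ * ∑ j : Fin N, unitExp ((j : ℕ) * x)

theorem sum_unitExp_mul_sub_one (N : ℕ) (x : ℝ) :
    (∑ j : Fin N, unitExp ((j : ℕ) * x)) * (unitExp x - 1) = unitExp (N * x) - 1 := by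
  simp only [unitExp_natCast_mul]
  rw [Fin.sum_univ_eq_sum_range (fun j => unitExp x ^ j), geom_sum_mul]

theorem consecutiveMask_eq_zero {N : ℕ} {x : ℝ} {k : ℤ} (hk : x = k / N) (hNk : ¬ (N : ℤ) ∣ k) :
    consecutiveMask N x = 0 := by
  rcases Nat.eq_zero_or_pos N with rfl | hN
  · simp [consecutiveMask]
  have hN' : (N : ℝ) ≠ 0 := by exact_mod_cast hN.ne'
  have h := sum_unitExp_mul_sub_one N x
  have e : (N : ℝ) * x = k := by
    rw [hk]
    field_simp
  rw [e, unitExp_intCast, sub_self, mul_eq_zero] at h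
  rw [consecutiveMask, h.resolve_right, mul_zero]
  rw [sub_eq_zero, unitExp_eq_one_iff]
  rintro ⟨n, hn⟩
  refine hNk ⟨n, ?_⟩
  rw [hn] at e
  exact_mod_cast e.symm

/-- By the geometric sum a zero makes `N * x` an integer, so `x = 0`, where the sum is `N`. -/
theorem consecutiveMask_ne_zero {N : ℕ} (hN : 0 < N) {x : ℝ} (hx : |N * x| < 1) :
    consecutiveMask N x ≠ 0 := by
  have hN' : (N : ℂ) ≠ 0 := by exact_mod_cast hN.ne'
  refine mul_ne_zero (inv_ne_zero hN') fun h0 => ?_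
  have h := sum_unitExp_mul_sub_one N x
  rw [h0, zero_mul, eq_comm, sub_eq_zero, unitExp_eq_one_iff] at h
  obtain ⟨n, hn⟩ := h
  rw [hn] at hx
  have hn0 : n = 0 := Int.abs_lt_one_iff.1 (by exact_mod_cast hx)
  have hx0 : x = 0 := by
    rw [hn0, Int.cast_zero, mul_eq_zero] at hn
    exact hn.resolve_left (by exact_mod_cast hN.ne')
  simp [hx0, hN.ne'] at h0

/-! ### The digit sets `D` and `L` form a Hadamard triple -/

section Digits

variable {n : ℕ}

/-- The digit `∑_i N^{e_i} a_i`. -/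
def productDigit (N : ℕ) (e : Fin n → ℕ) (a : Fin n → Fin N) : ℤ :=
  ∑ i, (N : ℤ) ^ e i * ((a i : ℕ) : ℤ)

/-- The dual digit `R ∑_i N^{q - 1 - e_i} a_i`. -/
def dualDigit (R N q : ℕ) (e : Fin n → ℕ) (a : Fin n → Fin N) : ℤ :=
  R * ∑ i, (N : ℤ) ^ (q - 1 - e i) * ((a i : ℕ) : ℤ)

theorem mask_productDigit (N : ℕ) (e : Fin n → ℕ) (x : ℝ) :
    mask (productDigit N e) x = ∏ i, consecutiveMask N ((N : ℝ) ^ e i * x) := by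
  simp only [mask, consecutiveMask, Finset.prod_mul_distrib, Finset.prod_univ_sum,
    Fintype.piFinset_univ]
  congr 1
  · simp
  · refine Finset.sum_congr rfl fun a _ => ?_
    have hsum : ∀ (t : Finset (Fin n)) (f : Fin n → ℝ),
        unitExp (∑ i ∈ t, f i) = ∏ i ∈ t, unitExp (f i) := by
      intro t f
      induction t using Finset.cons_induction with
      | empty => simp
      | cons i t hi ih => rw [Finset.sum_cons, Finset.prod_cons, unitExp_add, ih]
    rw [← hsum]
    congr 1
    simp only [productDigit]
    push_cast
    rw [Finset.sum_mul]
    exact Finset.sum_congr rfl fun i _ => by ring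

/-- Isolates why the weights of `L` are dual to those of `D`: the quotient is `1/N` for `j = i` and
an integer for `j < i`. -/
theorem pow_mul_dual_weight {R N q : ℕ} (hR : 0 < R) (hN : 0 < N) {i j : ℕ} (hij : j ≤ i)
    (hj : j < q) :
    (N : ℝ) ^ i * (R * (N : ℝ) ^ (q - 1 - j)) / (R * (N : ℝ) ^ q) = (N : ℝ) ^ (i - j) / N := by
  have hR' : (R : ℝ) ≠ 0 := by exact_mod_cast hR.ne'
  have hN' : (N : ℝ) ≠ 0 := by exact_mod_cast hN.ne'
  obtain ⟨k, rfl⟩ := Nat.exists_eq_add_of_le hij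
  obtain ⟨m, rfl⟩ := Nat.exists_eq_add_of_lt hj
  have e1 : j + m + 1 - 1 - j = m := by lia
  have e2 : j + k - j = k := by lia
  rw [e1, e2]
  field_simp
  ring

theorem isHadamardTriple_productDigit {R N q : ℕ} (hR : 0 < R) (hN : 0 < N) {e : Fin n → ℕ}
    (he : StrictMono e) (heq : ∀ i, e i < q) :
    IsHadamardTriple (R * N ^ q) (productDigit N e) (dualDigit R N q e) := by
  classical
  intro a b hab
  -- Taking the largest differing index removes every `j > i`, whose weights would bring higher
  -- powers of `N` into the denominator.
  obtain ⟨i, hi, hmax⟩ := Finset.exists_max_image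
    (Finset.univ.filter fun i => a i ≠ b i) id (by
      obtain ⟨i, hi⟩ := Function.ne_iff.1 hab
      exact ⟨i, by simpa using hi⟩)
  replace hi : a i ≠ b i := by simpa using hi
  replace hmax : ∀ j, i < j → a j = b j := fun j hj => by
    by_contra hne
    exact absurd (hmax j (by simpa using hne)) (not_le.2 hj)
  let c : Fin n → ℤ := fun j => ((b j : ℕ) : ℤ) - ((a j : ℕ) : ℤ)
  -- For `j > i` the subtraction truncates, harmlessly since `c j = 0`. Modulo `N` only `c i`
  -- survives, and `0 < |c i| < N`.
  let k : ℤ := ∑ j, c j * (N : ℤ) ^ (e i - e j)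
  rw [mask_productDigit]
  refine Finset.prod_eq_zero (Finset.mem_univ i) (consecutiveMask_eq_zero (k := k) ?_ ?_)
  · have hsub : (dualDigit R N q e b - dualDigit R N q e a : ℝ) =
        ∑ j, (c j : ℝ) * (R * (N : ℝ) ^ (q - 1 - e j)) := by
      simp only [dualDigit, c]
      push_cast
      rw [← mul_sub, ← Finset.sum_sub_distrib, Finset.mul_sum]
      exact Finset.sum_congr rfl fun j _ => by ring
    rw [hsub]
    simp only [k]
    push_cast
    rw [Finset.sum_div, Finset.sum_div, Finset.mul_sum]
    refine Finset.sum_congr rfl fun j _ => ?_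
    rcases le_or_gt j i with hj | hj
    · rw [mul_div_assoc (c j : ℝ) ((N : ℝ) ^ _),
        ← pow_mul_dual_weight hR hN (he.monotone hj) (heq j)]
      ring
    · simp [c, hmax j hj]
  · intro hdvd
    have hk : k = c i + ∑ j ∈ Finset.univ.erase i, c j * (N : ℤ) ^ (e i - e j) := by
      simp only [k]
      rw [← Finset.add_sum_erase _ _ (Finset.mem_univ i), Nat.sub_self, pow_zero, mul_one]
    have hrest : (N : ℤ) ∣ ∑ j ∈ Finset.univ.erase i, c j * (N : ℤ) ^ (e i - e j) := by
      refine Finset.dvd_sum fun j hj => ?_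
      rcases lt_or_gt_of_ne (Finset.ne_of_mem_erase hj) with hj | hj
      · exact (dvd_pow_self _ (Nat.sub_ne_zero_of_lt (he hj))).mul_left _
      · simp [c, hmax j hj]
    rw [hk, dvd_add_left hrest] at hdvd
    have hlt : |c i| < N := by
      have h1 := (a i).isLt
      have h2 := (b i).isLt
      simp only [c]
      rw [abs_lt]
      omega
    have h0 := Int.eq_zero_of_abs_lt_dvd hdvd hlt
    exact hi (Fin.ext (by simp only [c] at h0; lia))

theorem dualDigit_nonneg (R N q : ℕ) (e : Fin n → ℕ) (a : Fin n → Fin N) :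
    0 ≤ dualDigit R N q e a :=
  mul_nonneg (by positivity) (Finset.sum_nonneg fun i _ => by positivity)

/-- The exponents `q - 1 - e i` are distinct and below `q`, so the sum is a base-`N` numeral with at
most `q` digits. -/
theorem dualDigit_lt {R N q : ℕ} (hR : 0 < R) (hN : 0 < N) {e : Fin n → ℕ}
    (he : Function.Injective e) (heq : ∀ i, e i < q) (a : Fin n → Fin N) :
    dualDigit R N q e a < (R * N ^ q : ℕ) := by
  have hinj : Function.Injective fun i => q - 1 - e i := fun i j hij => he (by
    have := heq i
    have := heq j
    simp only at hij
    lia)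
  have hN1 : (0 : ℤ) ≤ N - 1 := by lia
  have h : ∑ i, (N : ℤ) ^ (q - 1 - e i) * ((a i : ℕ) : ℤ) < N ^ q := by
    calc ∑ i, (N : ℤ) ^ (q - 1 - e i) * ((a i : ℕ) : ℤ)
        ≤ ∑ i, (N : ℤ) ^ (q - 1 - e i) * (N - 1) := by
          refine Finset.sum_le_sum fun i _ => ?_
          have := (a i).isLt
          exact mul_le_mul_of_nonneg_left (by lia) (by positivity)
      _ = (∑ k ∈ Finset.univ.image fun i => q - 1 - e i, (N : ℤ) ^ k) * (N - 1) := by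
          rw [Finset.sum_image hinj.injOn, Finset.sum_mul]
      _ ≤ (∑ k ∈ Finset.range q, (N : ℤ) ^ k) * (N - 1) := by
          refine mul_le_mul_of_nonneg_right
            (Finset.sum_le_sum_of_subset_of_nonneg ?_ fun _ _ _ => by positivity) hN1
          intro k hk
          obtain ⟨i, -, rfl⟩ := Finset.mem_image.1 hk
          have := heq i
          rw [Finset.mem_range]
          lia
      _ < N ^ q := by
          rw [geom_sum_mul]
          lia
  rw [dualDigit]
  push_cast
  exact mul_lt_mul_of_pos_left h (by exact_mod_cast hR)

/-- Since `R ≥ 2` and `e i + 1 ≤ q`, the bound `2/(R N^q)` is at most `1/N^(e i + 1)`, so no factor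
reaches its first zero. -/
theorem mask_productDigit_ne_zero {R N q : ℕ} (hR : 1 < R) (hN : 0 < N) {e : Fin n → ℕ}
    (heq : ∀ i, e i < q) {x : ℝ} (hx : |x| < 2 / (R * N ^ q : ℕ)) :
    mask (productDigit N e) x ≠ 0 := by
  have hN' : (0 : ℝ) < N := by exact_mod_cast hN
  have hN1 : (1 : ℝ) ≤ N := by exact_mod_cast hN
  have hR' : (2 : ℝ) ≤ R := by exact_mod_cast hR
  rw [mask_productDigit]
  refine Finset.prod_ne_zero_iff.2 fun i _ => consecutiveMask_ne_zero hN ?_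
  push_cast at hx
  rw [lt_div_iff₀ (by positivity)] at hx
  have hpow : (N : ℝ) ^ (e i + 1) ≤ (N : ℝ) ^ q := pow_le_pow_right₀ hN1 (heq i)
  rw [← mul_assoc, ← pow_succ', abs_mul, abs_of_pos (by positivity)]
  have h1 : |x| * (2 * (N : ℝ) ^ (e i + 1)) ≤ |x| * (R * (N : ℝ) ^ q) := by gcongr
  linarith

theorem weightedDigitSum_pow_eq (N : ℕ) (e : Fin n → ℕ) :
    weightedDigitSum N (fun i => (N : ℝ) ^ e i) =
      Finset.univ.image fun a => (productDigit N e a : ℝ) := by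
  simp [weightedDigitSum, productDigit]

theorem image_weightedDigitSum_inv_pow_eq {R N q : ℕ} (hN : 0 < N) {e : Fin n → ℕ}
    (heq : ∀ i, e i < q) :
    (weightedDigitSum N fun i => 1 / (N : ℝ) ^ (e i + 1)).image
        (fun x => (R : ℝ) * (N : ℝ) ^ q * x) =
      Finset.univ.image fun a => (dualDigit R N q e a : ℝ) := by
  have hN' : (N : ℝ) ≠ 0 := by exact_mod_cast hN.ne'
  rw [weightedDigitSum, Finset.image_image]
  congr 1
  funext a
  simp only [Function.comp_apply, dualDigit]
  push_cast
  rw [mul_assoc, Finset.mul_sum]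
  congr 1
  refine Finset.sum_congr rfl fun i _ => ?_
  have e1 : q = (q - 1 - e i) + (e i + 1) := by
    have := heq i
    lia
  have e2 : (N : ℝ) ^ q = (N : ℝ) ^ (q - 1 - e i) * (N : ℝ) ^ (e i + 1) := by
    rw [← pow_add, ← e1]
  rw [e2]
  field_simp

end Digits

/-! ### The theorem -/

theorem theorem1p1 (R N q s : ℕ) (p : Fin s → ℕ)
    (hR : 1 < R) (hN : 1 < N) (hRN : Nat.Coprime R N) (hq : 0 < q)
    (hp_pos : ∀ i, 0 < p i) (hp_mono : StrictMono p) (hp_lt : ∀ i, p i < q) :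
    IsSpectralMeasure (selfSimilarMeasure ((R : ℝ) * (N : ℝ) ^ q) (digitSet N p)) ∧
      IsSpectrum (selfSimilarMeasure ((R : ℝ) * (N : ℝ) ^ q) (digitSet N p))
        (finiteExpansions ((R : ℝ) * (N : ℝ) ^ q) (spectrumDigitSet R N q p)) := by
  have hN0 : 0 < N := by lia
  have hR0 : 0 < R := by lia
  have : NeZero N := ⟨hN0.ne'⟩
  have he : StrictMono (exponents p) := Fin.strictMono_cons.2 ⟨fun _ => hp_pos _, hp_mono⟩
  have heq : ∀ i, exponents p i < q := Fin.cases hq hp_lt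
  have hM : 1 < R * N ^ q := Nat.one_lt_mul_iff.2 ⟨hR0, by positivity, Or.inl hR⟩
  have hcast : (R : ℝ) * (N : ℝ) ^ q = (R * N ^ q : ℕ) := by push_cast; rfl
  have hD : digitSet N p = Finset.univ.image fun a => (productDigit N (exponents p) a : ℝ) :=
    weightedDigitSum_pow_eq N _
  have hL : spectrumDigitSet R N q p =
      Finset.univ.image fun a => (dualDigit R N q (exponents p) a : ℝ) :=
    image_weightedDigitSum_inv_pow_eq hN0 heq
  rw [hD, hL, hcast]
  have hμ := (isSelfSimilarMeasure_iff (M := (R * N ^ q : ℕ)) (by exact_mod_cast hM)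
    (Finset.univ_nonempty.image fun a => (productDigit N (exponents p) a : ℝ))).2 rfl
  have hspec := (isHadamardTriple_productDigit hR0 hN0 he heq).isSpectrum hM
    -- The all-zero digit vector provides `0 ∈ L`, needed for padding.
    ⟨fun _ => 0, by simp [dualDigit]⟩ (dualDigit_nonneg R N q _)
    (dualDigit_lt hR0 hN0 he.injective heq)
    (fun x hx => mask_productDigit_ne_zero hR hN0 heq hx) hμ
  exact ⟨⟨hμ.isProbabilityMeasure, hμ.compactSupport, _, hspec⟩, hspec⟩
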